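/- Let $\mathbf k$ be an infinite field, let $\mathcal L\subseteq\mathbb Z^n$ be a lattice (a subgroup of $\mathbb Z^n$), and grade $S=\mathbf k[x_1,\dots,x_n]$ by $\mathbb Z^n/\mathcal L$ through $\deg(x_i)=e_i+\mathcal L$. Call an ideal $I\subseteq S$ $\mathcal L$-graded if it is homogeneous for this grading and $\dim_{\mathbf k}(S/I)_g=1$ for every $g$ in the image of $\mathbb N^n$ in $\mathbb Z^n/\mathcal L$. For an ideal $I\subseteq S$ let $\mathrm{Top}(I)$ be the intersection of the minimal primary components of $I$, that is, of the primary components in an irredundant primary decomposition of $I$ (components with pairwise distinct radicals, none superfluous) whose radicals are minimal primes of $I$ (these components do not depend on the decomposition). If $\mathcal L$ has dimension (rank) $2$ and $I$ and $I'$ are two distinct monomial $\mathcal L$-graded ideals of $S$, then $\mathrm{Top}(I)\neq\mathrm{Top}(I')$. -/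

import Mathlib

open MvPolynomial

/-- The degree of the variable `x_i` in the grading of `k[x_1, …, x_n]` by `ℤⁿ / L`:
the class of the unit vector `e_i`. -/
def latticeDegree {n : ℕ} (L : AddSubgroup (Fin n → ℤ)) (i : Fin n) : (Fin n → ℤ) ⧸ L :=
  QuotientAddGroup.mk (Pi.single i 1)

/-- The set `G⁺ = ℕⁿ / L` of degrees that occur in the grading: the image of `ℕⁿ` in `ℤⁿ / L`. -/
def occurringDegrees {n : ℕ} (L : AddSubgroup (Fin n → ℤ)) : Set ((Fin n → ℤ) ⧸ L) :=
  Set.range fun u : Fin n → ℕ => QuotientAddGroup.mk fun i => (u i : ℤ)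

/-- An ideal is homogeneous for the grading by `ℤⁿ / L` if it contains every homogeneous component
of each of its elements. -/
def IsLatticeHomogeneous {n : ℕ} {k : Type*} [Field k] (L : AddSubgroup (Fin n → ℤ))
    (I : Ideal (MvPolynomial (Fin n) k)) : Prop :=
  ∀ f ∈ I, ∀ g : (Fin n → ℤ) ⧸ L, weightedHomogeneousComponent (latticeDegree L) g f ∈ I

/-- The graded piece `(S / I)_g`: the image in `S / I` of the space `S_g` of homogeneous
polynomials of degree `g`. -/
noncomputable def quotientPiece {n : ℕ} {k : Type*} [Field k] (L : AddSubgroup (Fin n → ℤ))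
    (I : Ideal (MvPolynomial (Fin n) k)) (g : (Fin n → ℤ) ⧸ L) :
    Submodule k (MvPolynomial (Fin n) k ⧸ I) :=
  (weightedHomogeneousSubmodule k (latticeDegree L) g).map (Ideal.Quotient.mkₐ k I).toLinearMap

/-- `I` is `L`-graded: it is homogeneous and `dim_k (S / I)_g = 1` for all `g ∈ G⁺`. -/
structure IsLatticeGraded {n : ℕ} {k : Type*} [Field k] (L : AddSubgroup (Fin n → ℤ))
    (I : Ideal (MvPolynomial (Fin n) k)) : Prop where
  homogeneous : IsLatticeHomogeneous L I
  rank_eq_one : ∀ g ∈ occurringDegrees L, Module.rank k (quotientPiece L I g) = 1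

/-- A monomial ideal: an ideal generated by monomials. -/
def IsMonomialIdeal {n : ℕ} {k : Type*} [Field k] (I : Ideal (MvPolynomial (Fin n) k)) : Prop :=
  ∃ A : Set (Fin n →₀ ℕ), I = Ideal.span ((fun u => monomial u (1 : k)) '' A)

/-- `Q` is a minimal primary component of `I`: a member of an irredundant primary decomposition
of `I` whose radical is a minimal prime of `I`. -/
def IsMinimalPrimaryComponent {R : Type*} [CommRing R] (I Q : Ideal R) : Prop :=
  ∃ t : Finset (Ideal R),
    Submodule.IsMinimalPrimaryDecomposition I t ∧ Q ∈ t ∧ Q.radical ∈ I.minimalPrimes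

/-- `Top(I)`: the intersection of the minimal primary components of `I`.  (In a Noetherian ring
irredundant primary decompositions exist, and the component at a minimal prime is the same in all
of them.) -/
def idealTop {R : Type*} [CommRing R] (I : Ideal R) : Ideal R :=
  sInf {Q | IsMinimalPrimaryComponent I Q}

/-! The exponents outside a monomial `L`-graded ideal form a lower set `M` of coset representatives,
and such an ideal is determined by `M`. For a facet `F`, the variables off `F` generate a minimal
prime, so a translate of `ℕ^F` inside `M` consists of monomials outside `Top(I)`. If the tops agree,
every translated facet in `M` thus lies in `M'` (`IsFacet.translateSubset_of_idealTop_eq`). It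
remains to show `M = M'` in rank two. Representatives of one coset in `M` and `M'` differ by some `c
∈ L` with positive part in `M` and negative part in `M'`. A facet `F` attached to `c⁺` has two
coordinates off it (`IsFacet.card_compl`), so the real span of `L` is a plane with these
coordinates. There a convexity argument gives `l ∈ L` with `l ≤ c⁺` and `c⁺ - l` in both `M` and
`M'`; uniqueness forces `l = 0` and `l = c`. -/

/-- A set of lattice points in the orthant that is closed downwards and meets every coset of `L`
that meets the orthant in exactly one point. -/
structure IsOrthantTransversal {ι : Type*} (L : AddSubgroup (ι → ℤ)) (M : Set (ι → ℕ)) :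
    Prop where
  lower : IsLowerSet M
  exists_mem : ∀ u : ι → ℕ, ∃ s ∈ M, ∃ l ∈ L, ∀ i, (s i : ℤ) = u i - l i
  unique : ∀ s ∈ M, ∀ s' ∈ M, ∀ l ∈ L, (∀ i, l i = s i - s' i) → l = 0

/-- The translate of the face `ℕ^F` of the orthant by `s` is contained in `M`. -/
def TranslateSubset {ι : Type*} (M : Set (ι → ℕ)) (F : Set ι) (s : ι → ℕ) : Prop :=
  ∀ a : ι → ℕ, (∀ i ∉ F, a i = 0) → s + a ∈ M

/-- `F` is maximal among the sets with `ℕ^F ⊆ M`. -/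
def IsFacet {ι : Type*} (M : Set (ι → ℕ)) (F : Set ι) : Prop :=
  Maximal (fun G => TranslateSubset M G 0) F

/-! ### Facets of transversals -/

section Combinatorics

variable {ι : Type*} {L : AddSubgroup (ι → ℤ)} {M : Set (ι → ℕ)}

lemma TranslateSubset.mono (hM : IsLowerSet M) {F : Set ι} {s s' : ι → ℕ}
    (h : TranslateSubset M F s) (hs : ∀ i ∉ F, s' i ≤ s i) : TranslateSubset M F s' := by
  classical
  intro a ha
  refine hM ?_ (h (fun i => if i ∈ F then s' i + a i else 0) (by simp +contextual))
  intro i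
  by_cases hi : i ∈ F
  · simp [hi]
  · simpa [hi, ha i hi] using hs i hi

lemma TranslateSubset.mem (hM : IsLowerSet M) {F : Set ι} {s s' : ι → ℕ}
    (h : TranslateSubset M F s) (hs : ∀ i ∉ F, s' i ≤ s i) : s' ∈ M := by
  simpa using h.mono hM hs 0 (by simp)

/-- In a sequence of points of a lower set, the unbounded coordinates along a suitable subsequence
span a translated face. -/
lemma exists_subseq_translateSubset [Finite ι] (hM : IsLowerSet M) (f : ℕ → ι → ℕ)
    (hf : ∀ N, f N ∈ M) :
    ∃ (φ : ℕ → ℕ) (F : Set ι), StrictMono φ ∧ Monotone (f ∘ φ) ∧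
      (∀ N, ∀ i ∉ F, f (φ N) i = f (φ 0) i) ∧ TranslateSubset M F (f (φ 0)) := by
  classical
  have := Fintype.ofFinite ι
  obtain ⟨g, hg⟩ := (wellQuasiOrdered_le (α := ι → ℕ)).exists_monotone_subseq f
  have hmono : Monotone (f ∘ g) := fun a b hab => hg a b hab
  set F : Set ι := {i | ∀ K, ∃ N, K ≤ f (g N) i} with hF
  have hstab : ∀ i, ∃ N₀, i ∉ F → ∀ N ≥ N₀, f (g N) i = f (g N₀) i := by
    intro i
    by_cases hi : i ∈ F
    · exact ⟨0, fun h => (h hi).elim⟩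
    · simp only [hF, Set.mem_ofPred_eq, not_forall, not_exists, not_le] at hi
      obtain ⟨K, hK⟩ := hi
      have hb : BddAbove (Set.range fun N => f (g N) i) :=
        ⟨K, by rintro _ ⟨N, rfl⟩; exact (hK N).le⟩
      obtain ⟨N₀, hN₀⟩ := Nat.sSup_mem (Set.range_nonempty fun N => f (g N) i) hb
      refine ⟨N₀, fun _ N hN => le_antisymm ?_ (hmono hN i)⟩
      exact (le_csSup hb ⟨N, rfl⟩).trans hN₀.ge
  choose N₀ hN₀ using hstab
  set n₀ := Finset.univ.sup N₀
  have hle : ∀ i, N₀ i ≤ n₀ := fun i => Finset.le_sup (Finset.mem_univ i)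
  have hconst : ∀ N, ∀ i ∉ F, f (g (N + n₀)) i = f (g (0 + n₀)) i := by
    intro N i hi
    rw [hN₀ i hi (N + n₀) ((hle i).trans (by omega)), hN₀ i hi (0 + n₀) ((hle i).trans (by omega))]
  have hunb : ∀ i ∈ F, ∀ K, ∃ N, K ≤ f (g (N + n₀)) i := by
    intro i hi K
    obtain ⟨N, hN⟩ := hi K
    exact ⟨N, hN.trans (hmono (by omega : N ≤ N + n₀) i)⟩
  refine ⟨fun N => g (N + n₀), F, fun a b hab => g.strictMono (by omega),
    fun a b hab => hmono (by omega), hconst, ?_⟩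
  intro a ha
  have : ∀ i, ∃ N, i ∈ F → f (g (0 + n₀)) i + a i ≤ f (g (N + n₀)) i := by
    intro i
    by_cases hi : i ∈ F
    · obtain ⟨N, hN⟩ := hunb i hi (f (g (0 + n₀)) i + a i)
      exact ⟨N, fun _ => hN⟩
    · exact ⟨0, fun h => (hi h).elim⟩
  choose N hN using this
  refine hM ?_ (hf (g (Finset.univ.sup N + n₀)))
  intro i
  by_cases hi : i ∈ F
  · refine (hN i hi).trans (hmono ?_ i)
    have := Finset.le_sup (f := N) (Finset.mem_univ i)
    omega
  · simp [ha i hi, hconst _ i hi]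

/-- Coordinates in `F` are free, so both points can be padded there until they differ by exactly
`l`; uniqueness then applies. -/
lemma IsOrthantTransversal.eq_zero_of_translateSubset (hM : IsOrthantTransversal L M) {F : Set ι}
    {s s' : ι → ℕ} (hs : TranslateSubset M F s) (hs' : TranslateSubset M F s') {l : ι → ℤ}
    (hl : l ∈ L) (h : ∀ i ∉ F, l i = s i - s' i) : l = 0 := by
  classical
  refine hM.unique _ (hs (fun i => if i ∈ F then s' i + (l i).toNat else 0) (by simp +contextual))
    _ (hs' (fun i => if i ∈ F then s i + (-l i).toNat else 0) (by simp +contextual)) l hl ?_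
  intro i
  by_cases hi : i ∈ F
  · simp only [Pi.add_apply, hi, if_true]
    push_cast
    omega
  · simpa [hi] using h i hi

/-- A lattice vector that is non-positive off `F` and non-negative off `G` vanishes
if `ℕ^F` and `ℕ^G` are contained in the transversal. -/
lemma IsOrthantTransversal.eq_zero_of_signs (hM : IsOrthantTransversal L M) {F G : Set ι}
    (hF : TranslateSubset M F 0) (hG : TranslateSubset M G 0) {l : ι → ℤ} (hl : l ∈ L)
    (hlF : ∀ i ∉ F, l i ≤ 0) (hlG : ∀ i ∉ G, 0 ≤ l i) : l = 0 := by
  refine hM.unique (fun i => (l i).toNat) ?_ (fun i => (-l i).toNat) ?_ l hl ?_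
  · exact hF.mem hM.lower fun i hi => by have := hlF i hi; simp; omega
  · exact hG.mem hM.lower fun i hi => by have := hlG i hi; simp; omega
  · intro i
    omega

lemma exists_isFacet_ge [Finite ι] {F : Set ι} (hF : TranslateSubset M F 0) :
    ∃ G, F ⊆ G ∧ IsFacet M G :=
  (Set.toFinite {G : Set ι | TranslateSubset M G 0}).exists_le_maximal hF

lemma IsFacet.eq_of_subset {F G : Set ι} (hF : IsFacet M F) (hFG : F ⊆ G)
    (hG : TranslateSubset M G 0) : G = F :=
  (hFG.antisymm (hF.2 hG hFG)).symm

/-- Along a facet, every coset has a representative whose translate lies in the transversal. -/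
lemma IsOrthantTransversal.exists_translateSubset [Finite ι] (hM : IsOrthantTransversal L M)
    {F : Set ι} (hF : IsFacet M F) (t : ι → ℕ) :
    ∃ s, TranslateSubset M F s ∧ ∃ l ∈ L, ∀ i ∉ F, (s i : ℤ) = t i - l i := by
  classical
  choose f hfM l hl hfl using fun N : ℕ =>
    hM.exists_mem (t + fun i => if i ∈ F then N else 0)
  obtain ⟨φ, G, hφ, hmono, hconst, hG⟩ := exists_subseq_translateSubset hM.lower f hfM
  have hG0 : TranslateSubset M G 0 := hG.mono hM.lower (by simp)
  have hlt : φ 0 < φ 1 := hφ one_pos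
  have hle : ∀ i, f (φ 0) i ≤ f (φ 1) i := hmono zero_le_one
  -- Off `F` the target is fixed while `f` grows; off `G` the target grows while `f` is fixed. This
  -- gives the two sign conditions.
  have hd : l (φ 1) - l (φ 0) = 0 := by
    refine hM.eq_zero_of_signs hF.1 hG0 (L.sub_mem (hl _) (hl _)) ?_ ?_
    · intro i hi
      have h0 := hfl (φ 0) i
      have h1 := hfl (φ 1) i
      have := hle i
      simp only [Pi.add_apply, hi, if_false, Pi.sub_apply] at h0 h1 ⊢
      omega
    · intro i hi
      have h0 := hfl (φ 0) i
      have h1 := hfl (φ 1) i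
      have := hconst 1 i hi
      simp only [Pi.add_apply, Pi.sub_apply] at h0 h1 ⊢
      split_ifs at h0 h1 <;> push_cast at h0 h1 <;> omega
  have hFG : F ⊆ G := by
    intro i hi
    by_contra hiG
    have h0 := hfl (φ 0) i
    have h1 := hfl (φ 1) i
    have h2 := hconst 1 i hiG
    have h3 := congrFun hd i
    simp only [Pi.add_apply, hi, if_true, Pi.sub_apply, Pi.zero_apply] at h0 h1 h3
    push_cast at h0 h1
    omega
  obtain rfl := hF.eq_of_subset hFG hG0
  refine ⟨_, hG, l (φ 0), hl _, fun i hi => ?_⟩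
  simpa [hi] using hfl (φ 0) i

/-- Every point `u` of the orthant determines a facet `F`, together with the vertex `d / m`
of the polyhedron `{x ≤ u}` at which the constraints off `F` are tight. -/
lemma IsOrthantTransversal.exists_vertex [Finite ι] (hM : IsOrthantTransversal L M) (u : ι → ℕ) :
    ∃ F, IsFacet M F ∧ ∃ m : ℤ, 0 < m ∧ ∃ d ∈ L, (∀ i, d i ≤ m * u i) ∧
      ∀ i ∉ F, d i = m * u i := by
  choose f hfM l hl hfl using fun N : ℕ => hM.exists_mem (N • u)
  obtain ⟨φ, G, hφ, hmono, hconst, hG⟩ := exists_subseq_translateSubset hM.lower f hfM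
  obtain ⟨F, hGF, hF⟩ := exists_isFacet_ge (hG.mono hM.lower (s' := 0) (by simp))
  have hlt : φ 0 < φ 1 := hφ one_pos
  have hd : ∀ i, l (φ 1) i - l (φ 0) i =
      ((φ 1 : ℤ) - φ 0) * u i - (f (φ 1) i - f (φ 0) i) := by
    intro i
    have h0 := hfl (φ 0) i
    have h1 := hfl (φ 1) i
    simp only [Pi.smul_apply, smul_eq_mul] at h0 h1
    push_cast at h0 h1
    linarith
  refine ⟨F, hF, (φ 1 : ℤ) - φ 0, by omega, l (φ 1) - l (φ 0), L.sub_mem (hl _) (hl _), ?_, ?_⟩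
  · intro i
    have : f (φ 0) i ≤ f (φ 1) i := hmono zero_le_one i
    rw [Pi.sub_apply, hd]
    omega
  · intro i hi
    have := hconst 1 i fun h => hi (hGF h)
    rw [Pi.sub_apply, hd]
    omega

/-- Pushing the `N`-th member of an infinite family by `N` along `F` makes the limiting face contain
`F`, hence equal it; two members then agree off `F`. -/
lemma IsFacet.finite_translateSubset [Finite ι] (hM : IsLowerSet M) {F : Set ι}
    (hF : IsFacet M F) : {s | (∀ i ∈ F, s i = 0) ∧ TranslateSubset M F s}.Finite := by
  classical
  by_contra hinf
  have hinf : Set.Infinite _ := hinf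
  set f := hinf.natEmbedding with hf
  obtain ⟨φ, G, hφ, -, hconst, hG⟩ := exists_subseq_translateSubset hM
    (fun N => (f N).1 + fun i => if i ∈ F then N else 0)
    (fun N => (f N).2.2 _ (by simp +contextual))
  have hlt : φ 0 < φ 1 := hφ one_pos
  have hFG : F ⊆ G := by
    intro i hi
    by_contra hiG
    have := hconst 1 i hiG
    simp [hi, (f (φ 0)).2.1 i hi, (f (φ 1)).2.1 i hi] at this
    omega
  obtain rfl := hF.eq_of_subset hFG (hG.mono hM (by simp))
  refine hlt.ne' (f.injective (Subtype.ext (funext fun i => ?_)))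
  by_cases hi : i ∈ G
  · rw [(f (φ 0)).2.1 i hi, (f (φ 1)).2.1 i hi]
  · simpa [hi] using hconst 1 i hi

/-- All facets have codimension equal to the rank of the lattice. -/
lemma IsFacet.card_compl [Finite ι] (hM : IsOrthantTransversal L M) {F : Set ι}
    (hF : IsFacet M F) : Nat.card ↥Fᶜ = Module.finrank ℤ L := by
  classical
  have := Fintype.ofFinite ι
  let π : (ι → ℤ) →ₗ[ℤ] (↥Fᶜ → ℤ) := LinearMap.funLeft ℤ ℤ Subtype.val
  let L' : Submodule ℤ (ι → ℤ) := AddSubgroup.toIntSubmodule L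
  let Λ : Submodule ℤ (↥Fᶜ → ℤ) := L'.map π
  have hinj : Function.Injective (π.domRestrict L') := by
    rw [← LinearMap.ker_eq_bot, LinearMap.ker_eq_bot']
    rintro ⟨l, hl⟩ h
    refine Subtype.ext (hM.eq_zero_of_translateSubset hF.1 hF.1 hl fun i hi => ?_)
    rw [show (⟨l, hl⟩ : L').1 i = 0 from congrFun h ⟨i, hi⟩]
    simp
  have hrank : Module.finrank ℤ Λ = Module.finrank ℤ L := by
    have h := LinearMap.finrank_range_of_inj hinj
    rw [LinearMap.range_domRestrict] at h
    exact h
  rw [← hrank]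
  have hfin : Finite ((↥Fᶜ → ℤ) ⧸ Λ) := by
    set B := {s | (∀ i ∈ F, s i = 0) ∧ TranslateSubset M F s}
    have hB : B.Finite := hF.finite_translateSubset hM.lower
    let q : (ι → ℕ) → (↥Fᶜ → ℤ) ⧸ Λ := fun s => Λ.mkQ fun i => (s i.1 : ℤ)
    have hrep : ∀ t : ι → ℕ, q t ∈ q '' B := by
      intro t
      obtain ⟨s, hs, l, hl, hsl⟩ := hM.exists_translateSubset hF t
      refine ⟨fun i => if i ∈ F then 0 else s i, ⟨by simp +contextual, ?_⟩, ?_⟩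
      · exact hs.mono hM.lower (by simp +contextual)
      · refine (Submodule.Quotient.eq Λ).mpr ⟨-l, neg_mem hl, ?_⟩
        ext ⟨i, hi⟩
        have := hsl i hi
        have hi' : i ∉ F := hi
        simp [π, LinearMap.funLeft_apply, hi', this]
    -- Each integer vector is a difference of non-negative ones, whose classes come from the finite
    -- set `B`.
    have hcover : (Set.univ : Set ((↥Fᶜ → ℤ) ⧸ Λ)) ⊆
        Set.image2 (fun x y => x - y) (q '' B) (q '' B) := by
      intro x _
      obtain ⟨z, rfl⟩ := Λ.mkQ_surjective x
      refine ⟨_, hrep fun i => if h : i ∈ F then 0 else (z ⟨i, h⟩).toNat, _,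
        hrep fun i => if h : i ∈ F then 0 else (-z ⟨i, h⟩).toNat, ?_⟩
      simp only [q]
      rw [← map_sub]
      congr 1
      ext ⟨i, hi⟩
      have hi' : i ∉ F := hi
      simp only [Pi.sub_apply, hi', dif_neg, not_false_eq_true]
      omega
    exact Set.finite_univ_iff.mp (((hB.image q).image2 _ (hB.image q)).subset hcover)
  rw [(Submodule.finiteQuotient_iff Λ).mp hfin, Module.finrank_fintype_fun_eq_card,
    Nat.card_eq_fintype_card]

end Combinatorics

/-! ### Comparing two transversals in rank two -/

section Comparison

variable {ι : Type*} {L : AddSubgroup (ι → ℤ)} {M M' : Set (ι → ℕ)}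

lemma IsOrthantTransversal.eq_zero_of_posPart_mem_of_negPart_mem [Finite ι]
    (hL : Module.finrank ℤ L = 2) (hM : IsOrthantTransversal L M)
    (hM' : IsOrthantTransversal L M')
    (h : ∀ F s, IsFacet M F → TranslateSubset M F s → TranslateSubset M' F s)
    {c : ι → ℤ} (hc : c ∈ L) (hpos : (fun i => (c i).toNat) ∈ M)
    (hneg : (fun i => (-c i).toNat) ∈ M') : c = 0 := by
  classical
  by_contra hc0
  obtain ⟨F, hF, m, hm, d, hd, hdle, hdeq⟩ := hM.exists_vertex fun i => (c i).toNat
  -- Otherwise `c⁺` is supported on `F`, so it lies in `M'` together with `c⁻`.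
  have hp : ∃ p ∉ F, 0 < c p := by
    by_contra! hcon
    exact hc0 (hM'.unique _ ((h F 0 hF hF.1).mem hM'.lower (s' := fun i => (c i).toNat)
      fun i hi => by simpa using hcon i hi) _ hneg c hc fun i => by omega)
  have hq : ∃ q ∉ F, c q < 0 := by
    by_contra! hcon
    exact hc0 (hM.unique _ hpos _ (hF.1.mem hM.lower (s' := fun i => (-c i).toNat)
      fun i hi => by simpa using hcon i hi) c hc fun i => by omega)
  obtain ⟨p, hpF, hcp⟩ := hp
  obtain ⟨q, hqF, hcq⟩ := hq
  have hpq : p ≠ q := by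
    rintro rfl
    omega
  have hoff : ∀ i ∉ F, i = p ∨ i = q := by
    have hcard : Set.ncard Fᶜ = 2 := by
      rw [← hL, ← hF.card_compl hM, Nat.card_coe_set_eq]
    have : ({p, q} : Set ι) = Fᶜ := by
      refine Set.eq_of_subset_of_ncard_le ?_ (by rw [hcard, Set.ncard_pair hpq])
      rintro i (rfl | rfl) <;> assumption
    intro i hi
    have hi' : i ∈ Fᶜ := hi
    rw [← this] at hi'
    exact hi'
  obtain ⟨s, hs, l, hl, hsl⟩ := hM.exists_translateSubset hF fun i => (c i).toNat
  have hsp := hsl p hpF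
  have hsq := hsl q hqF
  -- If `l` were a point of the polygon, both transversals would have to choose it.
  have hout : ¬ ∀ i, l i ≤ (c i).toNat := by
    intro hle
    have hmem : ∀ i ∉ F, (((c i).toNat : ℤ) - l i).toNat ≤ s i := by
      intro i hi
      have := hsl i hi
      omega
    have hl0 : l = 0 := hM.unique _ hpos _ (hs.mem hM.lower hmem) l hl fun i => by
      have := hle i
      omega
    have hlc : l - c = 0 := hM'.unique _ hneg _ ((h F s hF hs).mem hM'.lower hmem) (l - c)
      (L.sub_mem hl hc) fun i => by
        have := hle i
        simp only [Pi.sub_apply]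
        omega
    exact hc0 (by rw [← sub_eq_zero.mp hlc, hl0])
  have hl0 : l ≠ 0 := by
    rintro rfl
    exact hout fun i => by simp
  have hlc : l ≠ c := by
    rintro rfl
    exact hout fun i => by omega
  -- Comparing points of the staircase at the corner `{p, q}`.
  have hcorner : ∀ x y x' y' : ℕ, x ≤ s p → y ≤ s q → x' ≤ s p → y' ≤ s q → ∀ v ∈ L,
      v p = x - x' → v q = y - y' → v = 0 := by
    intro x y x' y' hx hy hx' hy' v hv hvp hvq
    have hmono : ∀ x y : ℕ, x ≤ s p → y ≤ s q →
        TranslateSubset M F fun i => if i = p then x else y := by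
      intro x y hx hy
      refine hs.mono hM.lower fun i hi => ?_
      rcases hoff i hi with rfl | rfl
      · simpa using hx
      · simpa [hpq.symm] using hy
    refine hM.eq_zero_of_translateSubset (hmono x y hx hy) (hmono x' y' hx' hy') hv fun i hi => ?_
    rcases hoff i hi with rfl | rfl
    · simpa using hvp
    · simpa [hpq.symm] using hvq
  -- In coordinates `(p, q)`, `l = (c p - s p, -s q)`. If the bound fails, `l` or `-l` is a
  -- difference of two points of the box `[0, s p] × [0, s q]`.
  have hsp_lt : 2 * (s p : ℤ) < c p := by
    by_contra! hcon
    refine hl0 ?_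
    by_cases hlt : c p ≤ s p
    · exact neg_eq_zero.mp (hcorner (s p) (s q) (c p).toNat 0 le_rfl le_rfl (by omega) (by omega) (-l)
        (L.neg_mem hl) (by simp only [Pi.neg_apply]; omega) (by simp only [Pi.neg_apply]; omega))
    · exact hcorner (c p - s p).toNat 0 0 (s q) (by omega) (by omega) (by omega) le_rfl l hl
        (by omega) (by omega)
  have hsq_lt : 2 * (s q : ℤ) < -c q := by
    by_contra! hcon
    refine hlc (sub_eq_zero.mp ?_).symm
    by_cases hlt : -c q ≤ s q
    · exact hcorner (s p) (s q) 0 (-c q).toNat le_rfl le_rfl (by omega) (by omega) (c - l)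
        (L.sub_mem hc hl) (by simp only [Pi.sub_apply]; omega) (by simp only [Pi.sub_apply]; omega)
    · exact hcorner (s p) 0 0 (-c q - s q).toNat le_rfl (by omega) (by omega) (by omega) (c - l)
        (L.sub_mem hc hl) (by simp only [Pi.sub_apply]; omega) (by simp only [Pi.sub_apply]; omega)
  -- Hence `l` lies in the triangle with vertices `0`, `c` and `d / m`.
  obtain ⟨a, ha⟩ : ∃ a, a = c p := ⟨_, rfl⟩
  obtain ⟨b, hb⟩ : ∃ b, b = -c q := ⟨_, rfl⟩
  obtain ⟨x, hx⟩ : ∃ x : ℤ, x = s p := ⟨_, rfl⟩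
  obtain ⟨y, hy⟩ : ∃ y : ℤ, y = s q := ⟨_, rfl⟩
  have hcp' : ((c p).toNat : ℤ) = a := by omega
  have hcq' : ((c q).toNat : ℤ) = 0 := by omega
  have hdp := hdeq p hpF
  have hdq := hdeq q hqF
  rw [hcp'] at hdp hsp
  rw [hcq'] at hdq hsq
  have hlp : l p = a - x := by omega
  have hlq : l q = -y := by omega
  have hcp2 : c p = a := ha.symm
  have hcq2 : c q = -b := by omega
  -- This clears denominators in `l = (1 - x/a - y/b) (d/m) + (y/b) c`, an identity checked at `p`
  -- and `q` only. The weights are non-negative with sum `1 - x/a ≤ 1`, and `0`, `c`, `d/m` are all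
  -- bounded by `c⁺`.
  have hcomb : (m * a * b) • l - ((a * b - x * b - y * a) • d + (m * a * y) • c) = 0 := by
    refine hM.eq_zero_of_translateSubset hF.1 hF.1 (L.sub_mem (L.zsmul_mem hl _)
      (L.add_mem (L.zsmul_mem hd _) (L.zsmul_mem hc _))) fun i hi => ?_
    rcases hoff i hi with rfl | rfl
    · simp only [Pi.sub_apply, Pi.add_apply, Pi.smul_apply, smul_eq_mul, hlp, hdp, hcp2]
      simp
      ring
    · simp only [Pi.sub_apply, Pi.add_apply, Pi.smul_apply, smul_eq_mul, hlq, hdq, hcq2]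
      simp
      ring
  refine hout fun i => ?_
  have hi := congrFun hcomb i
  simp only [Pi.sub_apply, Pi.add_apply, Pi.smul_apply, smul_eq_mul, Pi.zero_apply] at hi
  have ha0 : 0 < a := by omega
  have hb0 : 0 < b := by omega
  have hx0 : 0 ≤ x := by omega
  have hy0 : 0 ≤ y := by omega
  have hxa : 2 * x < a := by omega
  have hyb : 2 * y < b := by omega
  obtain ⟨t, ht⟩ : ∃ t : ℤ, t = (c i).toNat := ⟨_, rfl⟩
  have hct : c i ≤ t := by omega
  have ht0 : 0 ≤ t := by omega
  have hdt : d i ≤ m * t := by simpa [ht] using hdle i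
  rw [← ht]
  have hk : 0 ≤ a * b - x * b - y * a := by nlinarith
  have h1 := mul_le_mul_of_nonneg_left hdt hk
  have h2 := mul_le_mul_of_nonneg_left hct (show 0 ≤ m * a * y by positivity)
  have h3 : 0 ≤ m * t * (x * b) := by positivity
  refine le_of_mul_le_mul_left ?_ (show 0 < m * a * b by positivity)
  nlinarith

/-- For a lattice of rank two, a transversal is determined by the translated facets
it contains. -/
theorem IsOrthantTransversal.eq_of_translateSubset [Finite ι]
    (hL : Module.finrank ℤ L = 2) (hM : IsOrthantTransversal L M)
    (hM' : IsOrthantTransversal L M')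
    (h : ∀ F s, IsFacet M F → TranslateSubset M F s → TranslateSubset M' F s) : M = M' := by
  have key : ∀ u ∈ M, ∀ v ∈ M', ∀ c ∈ L, (∀ i, c i = u i - v i) → u = v := by
    intro u hu v hv c hc hcuv
    have hc0 : c = 0 := eq_zero_of_posPart_mem_of_negPart_mem hL hM hM' h hc
      (hM.lower (fun i => by have := hcuv i; simp; omega) hu)
      (hM'.lower (fun i => by have := hcuv i; simp; omega) hv)
    ext i
    have := hcuv i
    rw [hc0, Pi.zero_apply] at this
    omega
  ext u
  constructor
  · intro hu
    obtain ⟨v, hv, l, hl, hlv⟩ := hM'.exists_mem u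
    rwa [key u hu v hv l hl fun i => by have := hlv i; omega]
  · intro hu
    obtain ⟨v, hv, l, hl, hlv⟩ := hM.exists_mem u
    rwa [← key v hv u hu (-l) (L.neg_mem hl) fun i => by
      have := hlv i; simp only [Pi.neg_apply]; omega]

end Comparison

/-! ### From ideals to transversals -/

section MonomialIdeals

variable {σ k : Type*} [Field k]

/-- The exponents of the monomials outside an ideal. -/
def standardExponents [Finite σ] (I : Ideal (MvPolynomial σ k)) : Set (σ → ℕ) :=
  {u | monomial (Finsupp.equivFunOnFinite.symm u) (1 : k) ∉ I}

lemma mem_standardExponents [Finite σ] {I : Ideal (MvPolynomial σ k)} {u : σ → ℕ} :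
    u ∈ standardExponents I ↔ monomial (Finsupp.equivFunOnFinite.symm u) (1 : k) ∉ I :=
  Iff.rfl

lemma isLowerSet_standardExponents [Finite σ] (I : Ideal (MvPolynomial σ k)) :
    IsLowerSet (standardExponents I) := by
  intro u v hvu hu hv
  refine hu (I.mem_of_dvd ?_ hv)
  refine monomial_dvd_monomial.mpr ⟨Or.inr fun i => ?_, dvd_rfl⟩
  exact hvu i

/-- The ideal generated by the variables outside `F` is the kernel of the evaluation that sets
these variables to zero. -/
lemma span_X_image_compl_eq_ker (F : Set σ) [DecidablePred (· ∈ F)] :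
    Ideal.span (X '' Fᶜ : Set (MvPolynomial σ k)) =
      RingHom.ker (aeval fun i => if i ∈ F then (X i : MvPolynomial σ k) else 0) := by
  refine le_antisymm (Ideal.span_le.mpr ?_) fun f hf => ?_
  · rintro _ ⟨i, hi, rfl⟩
    have hi : i ∉ F := hi
    simp [RingHom.mem_ker, hi]
  · have hcomp : (Ideal.Quotient.mkₐ k (Ideal.span (X '' Fᶜ : Set (MvPolynomial σ k)))).comp
        (aeval fun i => if i ∈ F then (X i : MvPolynomial σ k) else 0) =
        Ideal.Quotient.mkₐ k _ := by
      ext i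
      by_cases hi : i ∈ F
      · simp [hi]
      · have hX : (X i : MvPolynomial σ k) ∈ Ideal.span (X '' Fᶜ : Set (MvPolynomial σ k)) :=
          Ideal.subset_span ⟨i, hi, rfl⟩
        simpa [hi] using (Ideal.Quotient.eq_zero_iff_mem.mpr hX).symm
    rw [← Ideal.Quotient.eq_zero_iff_mem, ← Ideal.Quotient.mkₐ_eq_mk k, ← hcomp,
      AlgHom.comp_apply, RingHom.mem_ker.mp hf, map_zero]

lemma isPrime_span_X_image (G : Set σ) :
    (Ideal.span (X '' G : Set (MvPolynomial σ k))).IsPrime := by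
  classical
  rw [← compl_compl G, span_X_image_compl_eq_ker]
  exact RingHom.ker_isPrime _

lemma IsMonomialIdeal.mem_iff {n : ℕ} {I : Ideal (MvPolynomial (Fin n) k)}
    (hI : IsMonomialIdeal I) {f : MvPolynomial (Fin n) k} :
    f ∈ I ↔ ∀ m ∈ f.support, monomial m (1 : k) ∈ I := by
  obtain ⟨A, rfl⟩ := hI
  classical
  simp [mem_ideal_span_monomial_image, support_monomial]

lemma IsMonomialIdeal.ext {n : ℕ} {I I' : Ideal (MvPolynomial (Fin n) k)}
    (hI : IsMonomialIdeal I) (hI' : IsMonomialIdeal I')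
    (h : standardExponents I = standardExponents I') : I = I' := by
  ext f
  rw [hI.mem_iff, hI'.mem_iff]
  refine forall₂_congr fun m _ => not_iff_not.mp ?_
  have := Set.ext_iff.mp h m
  simpa [mem_standardExponents] using this

/-- For minimality: if `i ∉ F`, maximality of `F` puts in `I` a monomial in the variables of `F ∪
{i}`. A prime between `I` and the span contains one of these variables, which can only be `X i`. -/
lemma IsFacet.span_X_mem_minimalPrimes {n : ℕ} {I : Ideal (MvPolynomial (Fin n) k)}
    (hI : IsMonomialIdeal I) {F : Set (Fin n)} (hF : IsFacet (standardExponents I) F) :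
    Ideal.span (X '' Fᶜ) ∈ I.minimalPrimes := by
  classical
  refine ⟨⟨isPrime_span_X_image _, fun f hf => mem_ideal_span_X_image.mpr fun m hm => ?_⟩,
    fun J hJ hJF => Ideal.span_le.mpr ?_⟩
  · by_contra! hcon
    refine hF.1 m (fun i hi => hcon i hi) ?_
    simpa using hI.mem_iff.mp hf m hm
  · obtain ⟨hJ, hIJ⟩ := hJ
    rintro _ ⟨i, hi, rfl⟩
    have hnot : ¬ TranslateSubset (standardExponents I) (insert i F) 0 := fun h =>
      hi (hF.2 h (Set.subset_insert i F) (Set.mem_insert i F))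
    simp only [TranslateSubset, zero_add, mem_standardExponents, not_forall, not_not] at hnot
    obtain ⟨a, ha, haI⟩ := hnot
    have haJ := hIJ haI
    rw [monomial_eq, C_1, one_mul, Finsupp.prod, hJ.prod_mem_iff] at haJ
    obtain ⟨j, hj, hjJ⟩ := haJ
    have hXj := hJ.mem_of_pow_mem _ hjJ
    have hji : j = i ∨ j ∈ F := by
      by_contra hcon
      exact (Finsupp.mem_support_iff.mp hj) (ha j hcon)
    rcases hji with rfl | hjF
    · exact hXj
    · obtain ⟨l, hl, hlj⟩ := mem_ideal_span_X_image.mp (hJF hXj) (Finsupp.single j 1)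
        (by simp [support_X])
      obtain rfl : j = l := by
        by_contra hne
        exact hlj (Finsupp.single_eq_of_ne (Ne.symm hne))
      exact (hl hjF).elim

lemma le_idealTop {R : Type*} [CommRing R] (I : Ideal R) : I ≤ idealTop I := by
  refine le_sInf fun Q hQ => ?_
  obtain ⟨t, ht, hQt, -⟩ := hQ
  exact ht.inf_eq.symm.trans_le (Finset.inf_le hQt)

/-- An element of `Top(I)` is multiplied into `I` by some element outside a given minimal
prime of `I`. -/
lemma exists_mul_mem_of_mem_idealTop {R : Type*} [CommRing R] [IsNoetherianRing R] {I P : Ideal R}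
    (hP : P ∈ I.minimalPrimes) {x : R} (hx : x ∈ idealTop I) : ∃ y ∉ P, y * x ∈ I := by
  classical
  obtain ⟨t, ht⟩ := Submodule.IsLasker.exists_isMinimalPrimaryDecomposition (Submodule.isLasker R R) I
  obtain ⟨Q, hQt, hQP⟩ := Ideal.IsMinimalPrimaryDecomposition.minimalPrimes_subset_image_radical
    ht hP
  have hxQ : x ∈ Q := (sInf_le ⟨t, ht, hQt, hQP ▸ hP⟩ : idealTop I ≤ Q) hx
  -- Another component inside `P` would have radical `P` by minimality, against distinctness of
  -- radicals.
  have hnle : ¬ (t.erase Q).inf id ≤ P := by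
    intro hle
    obtain ⟨Q', hQ', hQ'P⟩ := (Ideal.IsPrime.inf_le' hP.1.1).mp hle
    obtain ⟨hne, hQ't⟩ := Finset.mem_erase.mp hQ'
    have hrad : Ideal.radical Q' ≤ P := hP.1.1.radical_le_iff.mpr hQ'P
    have heq : Ideal.radical Q' = P := le_antisymm hrad
      (hP.2 ⟨Ideal.isPrime_radical (ht.primary hQ't),
        ht.inf_eq.symm.trans_le ((Finset.inf_le hQ't).trans Ideal.le_radical)⟩ hrad)
    refine ht.distinct hQ't hQt hne ?_
    have hcolon : ∀ J : Ideal R, J.colon Set.univ = J := fun J => by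
      ext r
      refine ⟨fun h => by simpa using Submodule.mem_colon.mp h 1 (Set.mem_univ _),
        fun h => Submodule.mem_colon.mpr fun s _ => J.mul_mem_right s h⟩
    change (Q'.colon Set.univ).radical = (Q.colon Set.univ).radical
    rw [hcolon, hcolon, heq, hQP]
  obtain ⟨y, hy, hyP⟩ := SetLike.not_le_iff_exists.mp hnle
  refine ⟨y, hyP, ?_⟩
  rw [← ht.inf_eq, ← Finset.insert_erase hQt, Finset.inf_insert]
  exact ⟨Q.mul_mem_left y hxQ, Ideal.mul_mem_right x _ hy⟩

/-- A multiplier outside the minimal prime of `F` has a term supported on `F`, and this term moves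
`u` within `u + ℕ^F`, away from `I`. -/
lemma IsFacet.mem_standardExponents_idealTop {n : ℕ} {I : Ideal (MvPolynomial (Fin n) k)}
    (hI : IsMonomialIdeal I) {F : Set (Fin n)} (hF : IsFacet (standardExponents I) F)
    {u : Fin n → ℕ} (hu : TranslateSubset (standardExponents I) F u) :
    u ∈ standardExponents (idealTop I) := by
  intro hmem
  obtain ⟨y, hy, hyI⟩ := exists_mul_mem_of_mem_idealTop (hF.span_X_mem_minimalPrimes hI) hmem
  rw [mem_ideal_span_X_image] at hy
  push Not at hy
  obtain ⟨m, hm, hmF⟩ := hy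
  refine hu m (fun i hi => hmF i hi) ?_
  have hadd : Finsupp.equivFunOnFinite.symm (u + ⇑m) = m + Finsupp.equivFunOnFinite.symm u := by
    ext i
    simp [add_comm]
  rw [hadd]
  refine hI.mem_iff.mp hyI _ ?_
  rw [mem_support_iff, coeff_mul_monomial, mul_one]
  exact mem_support_iff.mp hm

lemma IsFacet.translateSubset_of_idealTop_eq {n : ℕ} {I I' : Ideal (MvPolynomial (Fin n) k)}
    (hI : IsMonomialIdeal I) (h : idealTop I = idealTop I') {F : Set (Fin n)} {u : Fin n → ℕ}
    (hF : IsFacet (standardExponents I) F) (hu : TranslateSubset (standardExponents I) F u) :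
    TranslateSubset (standardExponents I') F u := by
  intro a ha hmem
  refine hF.mem_standardExponents_idealTop hI (u := u + a) (fun b hb => ?_)
    (h ▸ le_idealTop I' hmem)
  rw [add_assoc]
  exact hu (a + b) fun i hi => by simp [ha i hi, hb i hi]

lemma weight_latticeDegree {n : ℕ} (L : AddSubgroup (Fin n → ℤ)) (u : Fin n →₀ ℕ) :
    Finsupp.weight (latticeDegree L) u = QuotientAddGroup.mk fun i => (u i : ℤ) := by
  have hsum : (fun i => (u i : ℤ)) = ∑ i, u i • (Pi.single i 1 : Fin n → ℤ) := by
    ext j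
    simp [Finset.sum_apply, Pi.single_apply]
  rw [hsum, Finsupp.weight_apply, Finsupp.sum_fintype _ _ (by simp)]
  change _ = QuotientAddGroup.mk' L _
  rw [map_sum]
  simp only [map_nsmul]
  rfl

/-- Monomials outside a monomial ideal are independent in the quotient and span it, so dimension one
means one such monomial per degree. -/
lemma IsLatticeGraded.isOrthantTransversal {n : ℕ} {L : AddSubgroup (Fin n → ℤ)}
    {I : Ideal (MvPolynomial (Fin n) k)} (hI : IsMonomialIdeal I) (hIL : IsLatticeGraded L I) :
    IsOrthantTransversal L (standardExponents I) where
  lower := isLowerSet_standardExponents I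
  exists_mem u := by
    by_contra! hcon
    have hbot : quotientPiece L I (QuotientAddGroup.mk fun i => (u i : ℤ)) = ⊥ := by
      rw [quotientPiece, eq_bot_iff, Submodule.map_le_iff_le_comap]
      intro f hf
      refine Ideal.Quotient.eq_zero_iff_mem.mpr (hI.mem_iff.mpr fun m hm => ?_)
      by_contra hmI
      have hdeg := hf (mem_support_iff.mp hm)
      rw [weight_latticeDegree, eq_comm, QuotientAddGroup.eq] at hdeg
      obtain ⟨i, hi⟩ := hcon m (by simpa [mem_standardExponents] using hmI) _
        (L.neg_mem hdeg)
      exact hi (by simp)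
    have h := hIL.rank_eq_one _ ⟨u, rfl⟩
    rw [hbot, rank_bot] at h
    exact zero_ne_one h
  unique s hs s' hs' l hl hls := by
    have h := hIL.rank_eq_one _ ⟨s, rfl⟩
    obtain ⟨v, -, hv⟩ := finrank_eq_one_iff'.mp (Module.rank_eq_one_iff_finrank_eq_one.mp h)
    have hmem : ∀ t : Fin n → ℕ, (QuotientAddGroup.mk fun i => (t i : ℤ) : (Fin n → ℤ) ⧸ L) =
        QuotientAddGroup.mk (fun i => (s i : ℤ)) →
        Ideal.Quotient.mk I (monomial (Finsupp.equivFunOnFinite.symm t) (1 : k)) ∈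
          quotientPiece L I (QuotientAddGroup.mk fun i => (s i : ℤ)) := by
      intro t ht
      refine ⟨_, isWeightedHomogeneous_monomial _ _ _ ?_, rfl⟩
      rw [weight_latticeDegree]
      exact ht
    have hdeg : (QuotientAddGroup.mk fun i => (s' i : ℤ) : (Fin n → ℤ) ⧸ L) =
        QuotientAddGroup.mk (fun i => (s i : ℤ)) := by
      rw [QuotientAddGroup.eq]
      convert hl using 1
      ext i
      simp [hls i]
      ring
    obtain ⟨a, ha⟩ := hv ⟨_, hmem s rfl⟩
    obtain ⟨b, hb⟩ := hv ⟨_, hmem s' hdeg⟩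
    have ha' := congrArg Subtype.val ha
    have hb' := congrArg Subtype.val hb
    simp only [Submodule.coe_smul] at ha' hb'
    by_contra hl0
    have hne : Finsupp.equivFunOnFinite.symm s ≠ Finsupp.equivFunOnFinite.symm s' := by
      intro heq
      have hss : s = s' := Finsupp.equivFunOnFinite.symm.injective heq
      exact hl0 (funext fun i => by simp [hls i, hss])
    have hb0 : b ≠ 0 := by
      rintro rfl
      rw [zero_smul] at hb'
      exact hs' (Ideal.Quotient.eq_zero_iff_mem.mp hb'.symm)
    have hrel : b • monomial (Finsupp.equivFunOnFinite.symm s) (1 : k) -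
        a • monomial (Finsupp.equivFunOnFinite.symm s') (1 : k) ∈ I := by
      rw [← Ideal.Quotient.eq_zero_iff_mem, ← Ideal.Quotient.mkₐ_eq_mk k, map_sub, map_smul,
        map_smul, Ideal.Quotient.mkₐ_eq_mk, ← ha', ← hb', smul_comm, sub_self]
    refine hs (hI.mem_iff.mp hrel _ ?_)
    rw [mem_support_iff]
    simp [coeff_monomial, hne.symm, hb0]

end MonomialIdeals

theorem corollary3p14 {k : Type*} [Field k] [Infinite k] (n : ℕ)
    (L : AddSubgroup (Fin n → ℤ)) (hL : Module.finrank ℤ L = 2)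
    (I I' : Ideal (MvPolynomial (Fin n) k))
    (hI : IsMonomialIdeal I) (hIL : IsLatticeGraded L I)
    (hI' : IsMonomialIdeal I') (hIL' : IsLatticeGraded L I')
    (hne : I ≠ I') :
    idealTop I ≠ idealTop I' := by
  intro h
  refine hne (hI.ext hI' ?_)
  exact (hIL.isOrthantTransversal hI).eq_of_translateSubset hL (hIL'.isOrthantTransversal hI')
    fun F s hF hs => hF.translateSubset_of_idealTop_eq hI h hs
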